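/- **Setting.** Let $X$ be a real Banach space. For every $T>0$ let $(E_T,\|\cdot\|_{E_T})$ be a real normed vector space of functions on $[0,T]$ with values in a real vector space $U$, two functions being identified when they agree $\mu$-almost everywhere on $[0,T]$, where $\mu$ is a fixed translation-invariant Borel measure on $\mathbb R$ (Lebesgue measure for classes of functions, counting measure for functions defined everywhere). Assume that $X$ is finite-dimensional or that all the spaces $E_T$ ($T>0$) are complete. Assume that for all $T_1,T_2>0$, $u\in E_{T_1}$, $v\in E_{T_2}$, the concatenation $$u\# v:=u\,\mathbf 1_{(0,T_1)}+v(\cdot-T_1)\,\mathbf 1_{(T_1,T_1+T_2)}$$ belongs to $E_{T_1+T_2}$ and $\|u\# v\|_{E_{T_1+T_2}}\le \|u\|_{E_{T_1}}+\|v\|_{E_{T_2}}$. Let $(\mathcal F_T)_{T>0}$ be a family of maps $\mathcal F_T:X\times E_T\to X$. **Definition.** A vector $\xi\in X$ is a *small-time $E$-continuously approximately reachable vector* if there is a continuous map $\Xi:[0,+\infty)\to X$ with $\Xi(0)=\xi$ such that for all $T>0$ there exist $C,\rho,s>0$ and a continuous map $b\in(-\rho,\rho)\mapsto u_b\in E_T$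 such that, for all $b\in(-\rho,\rho)$, $$\|\mathcal F_T(0,u_b)-b\,\Xi(T)\|_X\le C|b|^{1+s}\quad\text{and}\quad \|u_b\|_{E_T}\le C|b|^{s}.$$ **Theorem 2.1.** Assume that: * $(A_1)$ for all $T>0$, $\mathcal F_T$ is of class $C^2$ on a neighborhood of $(0,0)$ and $\mathcal F_T(0,0)=0$; * $(A_2)$ for all $x\in X$, the map $T\in(0,+\infty)\mapsto d\mathcal F_T(0,0).(x,0)\in X$ is continuous and tends to $x$ as $T\to0^+$; * $(A_3)$ for all $T_1,T_2>0$, $x\in X$, $u\in E_{T_1}$, $v\in E_{T_2}$: $\ \mathcal F_{T_1+T_2}(x,u\# v)=\mathcal F_{T_2}(\mathcal F_{T_1}(x,u),v)$; * $(A_4)$ the range $\mathcal H:=\operatorname{Ran} d\mathcal F_T(0,0).(0,\cdot)$ does not depend on $T>0$, is closed in $X$, and is of finite codimension $n$; * $(A_5)$ there is a complement $\mathcal M$ of $\mathcal H$ in $X$ (that is, $X=\mathcal H\oplus\mathcal M$) which admits a basis $(\xi_i)_{i=1,\dots,n}$ of small-time $E$-continuously approximately reachable vectors. Then for every $T>0$,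 $\mathcal F_T$ is locally onto from zero: for all $\eta>0$ there exists $\delta>0$ such that for all $x_f\in X$ with $\|x_f\|_X<\delta$ there exists $u\in E_T$ with $\|u\|_{E_T}<\eta$ and $\mathcal F_T(0,u)=x_f$. -/

import Mathlib

open Set Filter Topology MeasureTheory

namespace ControlVariations

/-- The vector space of `U`-valued functions on `[0, T]`, two functions being identified when they
agree `μ`-almost everywhere on `[0, T]`.  For `μ` the Lebesgue measure these are the usual classes
of functions (as in `L^∞(0,T)` or `H^k_0(0,T)`); for `μ` the counting measure no two distinct
functions on `[0, T]` are identified. No measurability of the functions is required. -/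
abbrev FunClass (μ : Measure ℝ) (T : ℝ) (U : Type*) : Type _ :=
  Germ (ae (μ.restrict (Icc 0 T))) U

section Concat

variable {U : Type*} [AddCommGroup U]

/-- The function `u 1_{(0,T₁)} + v(· - T₁) 1_{(T₁,T₁+T₂)}`. -/
noncomputable def concatFun (T₁ T₂ : ℝ) (u v : ℝ → U) : ℝ → U := fun t =>
  (Ioo 0 T₁).indicator u t + (Ioo T₁ (T₁ + T₂)).indicator (fun r => v (r - T₁)) t

theorem concatFun_congr (μ : Measure ℝ) [μ.IsAddRightInvariant] (T₁ T₂ : ℝ)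
    {u u' v v' : ℝ → U} (hu : u =ᵐ[μ.restrict (Icc 0 T₁)] u')
    (hv : v =ᵐ[μ.restrict (Icc 0 T₂)] v') :
    concatFun T₁ T₂ u v =ᵐ[μ.restrict (Icc 0 (T₁ + T₂))] concatFun T₁ T₂ u' v' := by
  rw [Filter.EventuallyEq, ae_restrict_iff' measurableSet_Icc] at hu hv
  have hv' := (measurePreserving_sub_right μ T₁).quasiMeasurePreserving.ae hv
  refine ae_restrict_of_ae ?_
  filter_upwards [hu, hv'] with t h₁ h₂
  have e₁ : (Ioo 0 T₁).indicator u t = (Ioo 0 T₁).indicator u' t := by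
    by_cases h : t ∈ Ioo 0 T₁
    · simp only [indicator_of_mem h]
      exact h₁ ⟨h.1.le, h.2.le⟩
    · simp only [indicator_of_notMem h]
  have e₂ : (Ioo T₁ (T₁ + T₂)).indicator (fun r => v (r - T₁)) t =
      (Ioo T₁ (T₁ + T₂)).indicator (fun r => v' (r - T₁)) t := by
    by_cases h : t ∈ Ioo T₁ (T₁ + T₂)
    · simp only [indicator_of_mem h]
      exact h₂ ⟨by linarith [h.1], by linarith [h.2]⟩
    · simp only [indicator_of_notMem h]
  simp only [concatFun, e₁, e₂]

/-- The concatenation `u # v` of (classes of) functions `u` on `[0, T₁]` and `v` on `[0, T₂]`. -/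
noncomputable def concat {μ : Measure ℝ} [μ.IsAddRightInvariant] {T₁ T₂ : ℝ}
    (u : FunClass μ T₁ U) (v : FunClass μ T₂ U) : FunClass μ (T₁ + T₂) U :=
  Quotient.map₂ (concatFun T₁ T₂)
    (fun _ _ hu _ _ hv => concatFun_congr μ T₁ T₂ hu hv) u v

end Concat

/-- `(E T)_{T > 0}` is a family of normed spaces of functions on `[0, T]`, stable under
concatenation, with `‖u # v‖ ≤ ‖u‖ + ‖v‖`.  The injective linear map `toFun T` exhibits `E T` as a
space of (classes of) functions.  Nothing is required for `T ≤ 0`. -/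
structure ControlFamily (μ : Measure ℝ) [μ.IsAddRightInvariant]
    (U : Type*) [AddCommGroup U] [Module ℝ U]
    (E : ℝ → Type*) [∀ T, NormedAddCommGroup (E T)] [∀ T, NormedSpace ℝ (E T)] where
  toFun : ∀ T, E T →ₗ[ℝ] FunClass μ T U
  injective : ∀ T, 0 < T → Function.Injective (toFun T)
  exists_concat : ∀ T₁ T₂, 0 < T₁ → 0 < T₂ → ∀ (u : E T₁) (v : E T₂),
    ∃ w : E (T₁ + T₂), toFun (T₁ + T₂) w = concat (toFun T₁ u) (toFun T₂ v)
  norm_concat_le : ∀ T₁ T₂, 0 < T₁ → 0 < T₂ → ∀ (u : E T₁) (v : E T₂) (w : E (T₁ + T₂)),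
    toFun (T₁ + T₂) w = concat (toFun T₁ u) (toFun T₂ v) → ‖w‖ ≤ ‖u‖ + ‖v‖

section Hypotheses

variable {X : Type*} [NormedAddCommGroup X] [NormedSpace ℝ X]
  {E : ℝ → Type*} [∀ T, NormedAddCommGroup (E T)] [∀ T, NormedSpace ℝ (E T)]

/-- `ξ` is a small-time `E`-continuously approximately reachable vector for the family `F` of
end-point maps. -/
def IsApproxReachable (F : ∀ T : ℝ, X × E T → X) (ξ : X) : Prop :=
  ∃ Ξ : ℝ → X, ContinuousOn Ξ (Ici 0) ∧ Ξ 0 = ξ ∧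
    ∀ T : ℝ, 0 < T → ∃ C ρ s : ℝ, 0 < C ∧ 0 < ρ ∧ 0 < s ∧
      ∃ u : ℝ → E T, ContinuousOn u (Ioo (-ρ) ρ) ∧
        ∀ b ∈ Ioo (-ρ) ρ,
          ‖F T (0, u b) - b • Ξ T‖ ≤ C * |b| ^ (1 + s) ∧ ‖u b‖ ≤ C * |b| ^ s

/-- For every `T > 0`, `F T` is of class `C^2` on a neighborhood of `(0, 0)` and vanishes there. -/
def IsC2NearZero (F : ∀ T : ℝ, X × E T → X) : Prop :=
  ∀ T : ℝ, 0 < T → F T (0, 0) = 0 ∧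
    ∃ V : Set (X × E T), IsOpen V ∧ (0, 0) ∈ V ∧ ContDiffOn ℝ 2 (F T) V

/-- For every `x`, the map `T ↦ dF_T(0,0).(x,0)` is continuous on `(0, ∞)` and extends
continuously to `T = 0` by the value `x`. -/
def LinearizationTimeContinuous (F : ∀ T : ℝ, X × E T → X) : Prop :=
  ∀ x : X, ContinuousOn (fun T : ℝ => fderiv ℝ (F T) (0, 0) (x, 0)) (Ioi 0) ∧
    Tendsto (fun T : ℝ => fderiv ℝ (F T) (0, 0) (x, 0)) (𝓝[>] 0) (𝓝 x)

/-- `F_{T₁+T₂}(x, u # v) = F_{T₂}(F_{T₁}(x, u), v)`. -/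
def SemigroupProperty {μ : Measure ℝ} [μ.IsAddRightInvariant]
    {U : Type*} [AddCommGroup U] [Module ℝ U]
    (𝓔 : ControlFamily μ U E) (F : ∀ T : ℝ, X × E T → X) : Prop :=
  ∀ T₁ T₂ : ℝ, 0 < T₁ → 0 < T₂ → ∀ (x : X) (u : E T₁) (v : E T₂) (w : E (T₁ + T₂)),
    𝓔.toFun (T₁ + T₂) w = concat (𝓔.toFun T₁ u) (𝓔.toFun T₂ v) →
      F (T₁ + T₂) (x, w) = F T₂ (F T₁ (x, u), v)

/-- The range of `dF_T(0,0).(0, ·)` is the same subspace `H` for all `T > 0`; it is closed and of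
finite codimension `n`. -/
def HasLinearizedRange (F : ∀ T : ℝ, X × E T → X) (H : Submodule ℝ X) (n : ℕ) : Prop :=
  (∀ T : ℝ, 0 < T → Set.range (fun u : E T => fderiv ℝ (F T) (0, 0) (0, u)) = (H : Set X)) ∧
    IsClosed (H : Set X) ∧ FiniteDimensional ℝ (X ⧸ H) ∧ Module.finrank ℝ (X ⧸ H) = n

/-- Some algebraic complement of `H` has a basis made of `n` approximately reachable vectors. -/
def HasReachableComplement (F : ∀ T : ℝ, X × E T → X) (H : Submodule ℝ X) (n : ℕ) : Prop :=
  ∃ M : Submodule ℝ X, IsCompl H M ∧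
    ∃ ξ : Module.Basis (Fin n) ℝ M, ∀ i, IsApproxReachable F (ξ i : X)

end Hypotheses

end ControlVariations

/-!
The controls steering `0` to a small target are concatenations of three pieces: the zero control,
which makes the total time equal to `T`; the controls attached to the reachable vectors `ξ i`, with
small parameters `b i`, used one after the other; and a control `y` used during a last short time.

To first order the end-point after the second piece is `∑ b i • ζ i`, where `ζ i` is a curve `Ξ i`
evaluated at a small time and then transported by the linearized flow for a small time; so `ζ i` is
close to `ξ i` (`exists_isRealized_near`), and the `ζ i` still span a complement of `H`. Only this
first-order expansion and the continuity in `b` of the end-point are available. The controls, of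
size `|b| ^ s`, may be much larger than their effect; that their nonlinear interaction with the
state nevertheless remains `o(b)` is due to the strict differentiability of the end-point maps at
`(0, 0)` (`hasFDerivAt_comp_control`).

The last piece covers `H` to first order. The equation `F (x b, y) = x_f` is then solved by a
Lyapunov–Schmidt reduction (`nhds_zero_le_map_of_hasStrictFDerivAt`). Its component along `H` is
solved for `y` as a continuous function of `b`. The kernel of the linearized control map need not be
complemented, so the implicit function theorem does not apply; instead, Newton's method is run in
the space of continuous functions of `b` (`exists_continuousMap_solution`), on which the linearized
control map remains surjective (`surjective_compLeftContinuous`). The remaining equation, in as many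
unknowns as the codimension of `H`, is a small continuous perturbation of the identity and has a
solution by Brouwer's theorem (`exists_eq_zero_of_norm_sub_le`). The latter is obtained by Milnor's
and Rogers' volume argument: if a ball retracted onto its boundary through `id + q`, the integral
over the ball of `det (1 + t • Dq)`, which is a polynomial in `t`, would be the volume of the ball
for small `t` and zero for `t = 1`.

When `X` is finite-dimensional, the space of controls is replaced by a finite-dimensional one,
given by a right inverse of the linearized control map.
-/

namespace ControlVariations

/-! ### Brouwer's theorem by the volume argument -/

open Metric Polynomial in
/-- Along a line of linear maps through the identity, the determinant is a polynomial of degree at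
most the dimension, so its value at time `1` is an affine combination, with universal weights, of
its values at arbitrarily small positive times. -/
theorem exists_weights_det_one_add (V : Type*) [NormedAddCommGroup V] [NormedSpace ℝ V]
    [FiniteDimensional ℝ V] {τ : ℝ} (hτ : 0 < τ) :
    ∃ (N : ℕ) (w t : Fin N → ℝ), ∑ j, w j = 1 ∧ (∀ j, 0 < t j ∧ t j < τ) ∧
      ∀ A : V →L[ℝ] V, (1 + A).det = ∑ j, w j * (1 + t j • A).det := by
  classical
  let n := Module.finrank ℝ V
  let t : Fin (n + 1) → ℝ := fun j => τ / (j + 2)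
  have hinj : Function.Injective t := by
    intro i j hij
    simp only [t] at hij
    rw [div_eq_div_iff (by positivity) (by positivity)] at hij
    have := mul_left_cancel₀ hτ.ne' hij
    ext
    have h2 : (i : ℝ) = j := by linarith
    exact_mod_cast h2
  refine ⟨n + 1, fun j => (Lagrange.basis Finset.univ t j).eval 1, t, ?_, ?_, ?_⟩
  · rw [← eval_finsetSum, Lagrange.sum_basis hinj.injOn Finset.univ_nonempty, eval_one]
  · intro j
    refine ⟨by positivity, ?_⟩
    rw [div_lt_iff₀ (by positivity)]
    nlinarith [(Nat.cast_nonneg (j : ℕ) : (0 : ℝ) ≤ j)]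
  · intro A
    let b := Module.finBasis ℝ V
    let M := LinearMap.toMatrix b b (A : V →ₗ[ℝ] V)
    let P : ℝ[X] := ((X : ℝ[X]) • M.map C + (1 : Matrix _ _ ℝ).map C).det
    have hP : ∀ s : ℝ, (1 + s • A).det = P.eval s := by
      intro s
      have h1 : P.eval s = (s • M + 1).det := by
        simp only [P]
        rw [← coe_evalRingHom, RingHom.map_det]
        congr 1
        ext i j
        simp only [RingHom.mapMatrix_apply, Matrix.map_apply, Matrix.add_apply, Matrix.smul_apply,
          smul_eq_mul, coe_evalRingHom, eval_add, eval_mul, eval_X, eval_C]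
      rw [h1, ContinuousLinearMap.det, ← LinearMap.det_toMatrix b]
      have h2 : ((1 + s • A : V →L[ℝ] V) : V →ₗ[ℝ] V) = s • (A : V →ₗ[ℝ] V) + 1 := by
        ext x; simp [add_comm]
      rw [h2, map_add, map_smul, LinearMap.toMatrix_one]
    have hdeg : P.degree < (Finset.univ : Finset (Fin (n + 1))).card := by
      refine lt_of_le_of_lt degree_le_natDegree ?_
      have := natDegree_det_X_add_C_le M 1
      rw [Fintype.card_fin] at this
      rw [Finset.card_univ, Fintype.card_fin]
      exact_mod_cast Nat.lt_succ_of_le this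
    have h := Lagrange.eq_interpolate (v := t) hinj.injOn hdeg
    have h1 := hP 1
    rw [one_smul] at h1
    rw [h1]
    conv_lhs => rw [h]
    rw [Lagrange.interpolate_apply, eval_finsetSum]
    refine Finset.sum_congr rfl fun j _ => ?_
    rw [eval_mul, eval_C, hP (t j), mul_comm]

/-- A bijection that is the identity off a set preserves that set. -/
theorem image_eq_of_bijective_of_eq_off {V : Type*} {h : V → V} (hh : Function.Bijective h)
    {s : Set V} (hs : ∀ x ∉ s, h x = x) : h '' s = s := by
  apply Subset.antisymm
  · rintro _ ⟨x, hx, rfl⟩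
    by_contra hn
    exact hn (by rwa [hh.1 (hs _ hn)])
  · intro y hy
    obtain ⟨x, rfl⟩ := hh.2 y
    by_cases hx : x ∈ s
    · exact ⟨x, hx, rfl⟩
    · rw [hs x hx] at hy
      exact absurd hy hx

open scoped NNReal in
theorem bijective_id_add_smul {V : Type*} [NormedAddCommGroup V] [NormedSpace ℝ V]
    [CompleteSpace V] {q : V → V} {K : ℝ≥0} (hq : LipschitzWith K q) {t : ℝ} (ht : |t| * K < 1) :
    Function.Bijective fun x => x + t • q x := by
  rcases subsingleton_or_nontrivial V with hV | hV
  · exact ⟨Function.injective_of_subsingleton _, fun y => ⟨y, Subsingleton.elim _ _⟩⟩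
  let c : ℝ≥0 := ⟨|t| * K, by positivity⟩
  have happ : ApproximatesLinearOn (fun x => x + t • q x)
      ((ContinuousLinearEquiv.refl ℝ V : V ≃L[ℝ] V) : V →L[ℝ] V) univ c := by
    intro x _ y _
    have h1 : x + t • q x - (y + t • q y) -
        ((ContinuousLinearEquiv.refl ℝ V : V ≃L[ℝ] V) : V →L[ℝ] V) (x - y) =
        t • (q x - q y) := by
      simp [smul_sub]; abel
    rw [h1, norm_smul, Real.norm_eq_abs]
    calc |t| * ‖q x - q y‖ ≤ |t| * (K * ‖x - y‖) := by
          gcongr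
          simpa [dist_eq_norm] using hq.dist_le_mul x y
      _ = c * ‖x - y‖ := (mul_assoc _ _ _).symm
  have hN : ‖((ContinuousLinearEquiv.refl ℝ V).symm : V →L[ℝ] V)‖₊ = 1 := by
    ext; simp
  have hc : c < ‖((ContinuousLinearEquiv.refl ℝ V).symm : V →L[ℝ] V)‖₊⁻¹ := by
    rw [hN, inv_one, ← NNReal.coe_lt_coe]
    exact ht
  exact ⟨injOn_univ.1 (happ.injOn (Or.inr hc)), happ.surjective (Or.inr hc)⟩

open Metric in
open scoped NNReal in
/-- Milnor's volume argument.  For small `t` the map `id + t q` is a bijection of the ball, so the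
integral of its Jacobian determinant is the volume of the ball; the integral being a polynomial in
`t`, this persists at `t = 1`. -/
theorem setIntegral_det_one_add_fderiv {V : Type*} [NormedAddCommGroup V] [NormedSpace ℝ V]
    [FiniteDimensional ℝ V] [MeasurableSpace V] [BorelSpace V] (ν : Measure V)
    [ν.IsAddHaarMeasure] {q : V → V} {K : ℝ≥0} (hq : LipschitzWith K q) {R : ℝ}
    (hd : DifferentiableOn ℝ q (ball 0 R)) (h0 : ∀ x ∉ ball (0 : V) R, q x = 0) :
    ∫ x in ball (0 : V) R, (1 + fderiv ℝ q x).det ∂ν = ν.real (ball 0 R) := by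
  have hcont : Continuous fun A : V →L[ℝ] V => A.det := ContinuousLinearMap.continuous_det
  have hmeas : Measurable (fderiv ℝ q) := measurable_fderiv ℝ q
  have hbound : ∀ x, ‖fderiv ℝ q x‖ ≤ K := fun x => norm_fderiv_le_of_lipschitz ℝ hq
  have hfin : ν (ball (0 : V) R) ≠ ⊤ := measure_ball_lt_top.ne
  have hint : ∀ t : ℝ, IntegrableOn (fun x => (1 + t • fderiv ℝ q x).det) (ball 0 R) ν := by
    intro t
    have hc2 : Continuous fun A : V →L[ℝ] V => (1 + t • A).det :=
      hcont.comp (by fun_prop)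
    obtain ⟨C, hC⟩ := (isCompact_closedBall (0 : V →L[ℝ] V) K).exists_bound_of_continuousOn
      hc2.continuousOn
    refine Measure.integrableOn_of_bounded (M := C) hfin
      (hc2.measurable.comp hmeas).aestronglyMeasurable ?_
    exact Eventually.of_forall fun x => hC _ (by simpa using hbound x)
  -- positivity of the determinant near the identity
  have hpos : ∀ᶠ A : V →L[ℝ] V in 𝓝 0, 0 < (1 + A).det := by
    have : ContinuousAt (fun A : V →L[ℝ] V => (1 + A).det) 0 :=
      (hcont.comp (continuous_const.add continuous_id)).continuousAt
    refine this.eventually_const_lt ?_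
    simp [ContinuousLinearMap.det]
  obtain ⟨δ, hδ, hδ'⟩ := Metric.eventually_nhds_iff.1 hpos
  obtain ⟨τ, hτ, hτ1, hτ2⟩ : ∃ τ : ℝ, 0 < τ ∧ τ * (K + 1) ≤ 1 ∧ τ * (K + 1) ≤ δ := by
    refine ⟨min 1 δ / (K + 1), by positivity, ?_, ?_⟩ <;>
      rw [div_mul_cancel₀ _ (by positivity)] <;> simp
  have hsmall : ∀ t : ℝ, 0 < t → t < τ →
      ∫ x in ball (0 : V) R, (1 + t • fderiv ℝ q x).det ∂ν = ν.real (ball 0 R) := by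
    intro t ht htτ
    have htK : t * (K + 1) < τ * (K + 1) := by gcongr
    have ht1 : |t| * K < 1 := by rw [abs_of_pos ht]; nlinarith
    have hbij := bijective_id_add_smul hq ht1
    have himg : (fun x => x + t • q x) '' ball 0 R = ball 0 R :=
      image_eq_of_bijective_of_eq_off hbij fun x hx => by simp [h0 x hx]
    have hder : ∀ x ∈ ball (0 : V) R, HasFDerivWithinAt (fun x => x + t • q x)
        (1 + t • fderiv ℝ q x) (ball 0 R) x := by
      intro x hx
      have h1 : HasFDerivAt q (fderiv ℝ q x) x :=
        (hd.differentiableAt (isOpen_ball.mem_nhds hx)).hasFDerivAt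
      exact ((hasFDerivAt_id x).add (h1.const_smul t)).hasFDerivWithinAt
    have hcv := integral_image_eq_integral_abs_det_fderiv_smul ν measurableSet_ball hder
      hbij.1.injOn (fun _ => (1 : ℝ))
    rw [himg] at hcv
    simp only [smul_eq_mul, mul_one, integral_const, MeasurableSet.univ, measureReal_restrict_apply,
      univ_inter] at hcv
    rw [hcv]
    refine setIntegral_congr_fun measurableSet_ball fun x _ => ?_
    refine (abs_of_pos (hδ' ?_)).symm
    rw [dist_zero_right, norm_smul, Real.norm_eq_abs, abs_of_pos ht]
    have := hbound x
    nlinarith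
  obtain ⟨N, w, t, hw, ht, hdet⟩ := exists_weights_det_one_add V hτ
  rw [funext fun x => hdet (fderiv ℝ q x)]
  rw [integral_finsetSum _ fun j _ => (hint (t j)).const_mul (w j)]
  simp_rw [integral_const_mul]
  rw [Finset.sum_congr rfl fun j _ => by rw [hsmall (t j) (ht j).1 (ht j).2],
    ← Finset.sum_mul, hw, one_mul]

open Metric in
open scoped NNReal in
/-- A function that is Lipschitz on a closed ball and vanishes off the open ball is Lipschitz:
a segment leaving the ball crosses the sphere. -/
theorem lipschitzWith_of_lipschitzOnWith_closedBall {V W : Type*} [NormedAddCommGroup V]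
    [NormedSpace ℝ V] [NormedAddCommGroup W] {q : V → W} {K : ℝ≥0} {R : ℝ}
    (hq : LipschitzOnWith K q (closedBall 0 R)) (h0 : ∀ x ∉ ball (0 : V) R, q x = 0) :
    LipschitzWith K q := by
  have key : ∀ x ∈ closedBall (0 : V) R, ∀ y ∉ closedBall (0 : V) R,
      dist (q x) (q y) ≤ K * dist x y := by
    intro x hx y hy
    rw [mem_closedBall_zero_iff] at hx hy
    have hc : ContinuousOn (fun s : ℝ => ‖AffineMap.lineMap x y s‖) (Icc 0 1) := by
      have : Continuous fun s : ℝ => (AffineMap.lineMap x y s : V) := AffineMap.lineMap_continuous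
      fun_prop
    obtain ⟨s, hs, hs'⟩ := intermediate_value_Icc zero_le_one hc
      (show R ∈ Icc _ _ by simpa using ⟨hx, (not_le.1 hy).le⟩)
    set z : V := AffineMap.lineMap x y s with hz_def
    have hzR : ‖z‖ = R := hs'
    have hz : q z = 0 := h0 z (by simp [hzR])
    have hy0 : q y = 0 := h0 y (by simpa using (not_le.1 hy).le)
    calc dist (q x) (q y) = dist (q x) (q z) := by rw [hz, hy0]
      _ ≤ K * dist x z := hq.dist_le_mul x (by simpa using hx) z (by simp [hzR])
      _ ≤ K * dist x y := by
        gcongr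
        simp only [z, dist_left_lineMap, Real.norm_eq_abs, abs_of_nonneg hs.1]
        exact mul_le_of_le_one_left dist_nonneg hs.2
  refine LipschitzWith.of_dist_le_mul fun x y => ?_
  by_cases hx : x ∈ closedBall (0 : V) R
  · by_cases hy : y ∈ closedBall (0 : V) R
    · exact hq.dist_le_mul x hx y hy
    · exact key x hx y hy
  · by_cases hy : y ∈ closedBall (0 : V) R
    · rw [dist_comm, dist_comm x]
      exact key y hy x hx
    · rw [h0 x fun h => hx (ball_subset_closedBall h), h0 y fun h => hy (ball_subset_closedBall h),
        dist_self]
      positivity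

open Metric in
/-- There is no smooth map from a closed ball to its boundary sphere which restricts to the
identity of the sphere. -/
theorem not_contDiff_retraction {V : Type*} [NormedAddCommGroup V] [InnerProductSpace ℝ V]
    [FiniteDimensional ℝ V] {R : ℝ} (hR : 0 < R) {r : V → V} (hr : ContDiff ℝ 1 r)
    (hrR : ∀ x, ‖r x‖ = R) (hid : ∀ x, ‖x‖ = R → r x = x) : False := by
  borelize V
  let ν : Measure V := Measure.addHaar
  let q : V → V := (closedBall 0 R).indicator fun x => r x - x
  have hq0 : ∀ x ∉ ball (0 : V) R, q x = 0 := by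
    intro x hx
    by_cases hx' : x ∈ closedBall (0 : V) R
    · have : ‖x‖ = R := by
        simp only [mem_ball_zero_iff, not_lt] at hx
        exact le_antisymm (by simpa using hx') hx
      simp [q, indicator_of_mem hx', hid x this]
    · simp [q, indicator_of_notMem hx']
  have hsm : ContDiff ℝ 1 fun x => r x - x := hr.sub contDiff_id
  obtain ⟨K, hK⟩ := (hsm.locallyLipschitz.locallyLipschitzOn
    (s := closedBall 0 R)).exists_lipschitzOnWith_of_compact (isCompact_closedBall _ _)
  have hqL : LipschitzWith K q := by
    refine lipschitzWith_of_lipschitzOnWith_closedBall (R := R) (fun x hx y hy => ?_) hq0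
    simp only [q, indicator_of_mem hx, indicator_of_mem hy]
    exact hK hx hy
  have hqe : ∀ x ∈ ball (0 : V) R, HasFDerivAt q (fderiv ℝ r x - 1) x := by
    intro x hx
    have h1 : HasFDerivAt (fun x => r x - x) (fderiv ℝ r x - 1) x :=
      (hr.differentiable one_ne_zero x).hasFDerivAt.sub (hasFDerivAt_id x)
    refine h1.congr_of_eventuallyEq ?_
    filter_upwards [isOpen_ball.mem_nhds hx] with y hy
    exact indicator_of_mem (ball_subset_closedBall hy) _
  have hvol := setIntegral_det_one_add_fderiv ν hqL
    (fun x hx => (hqe x hx).differentiableAt.differentiableWithinAt) hq0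
  -- the derivative of `r` takes its values in the hyperplane orthogonal to `r x`
  have hdet : ∀ x ∈ ball (0 : V) R, (1 + fderiv ℝ q x).det = 0 := by
    intro x hx
    rw [(hqe x hx).fderiv, add_sub_cancel]
    by_contra hne
    obtain ⟨v, hv⟩ := (LinearMap.equivOfDetNeZero _ hne).surjective (r x)
    have hv' : fderiv ℝ r x v = r x := hv
    have h1 : HasFDerivAt r (fderiv ℝ r x) x := (hr.differentiable one_ne_zero x).hasFDerivAt
    have h2 := h1.norm_sq
    simp only [hrR] at h2
    have h3 := congrArg (fun A => A v) (h2.unique (hasFDerivAt_const (R ^ 2) x))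
    simp [hv', hrR, hR.ne'] at h3
  rw [setIntegral_congr_fun measurableSet_ball hdet, integral_zero] at hvol
  have : 0 < ν.real (ball (0 : V) R) :=
    ENNReal.toReal_pos (measure_ball_pos ν 0 hR).ne' measure_ball_lt_top.ne
  exact this.ne hvol

open Metric in
/-- A form of Brouwer's theorem: a continuous map of a finite-dimensional space that is the
identity off a compact set has a zero. -/
theorem exists_add_eq_zero_of_hasCompactSupport {V : Type*} [NormedAddCommGroup V]
    [InnerProductSpace ℝ V] [FiniteDimensional ℝ V] {p : V → V} (hp : Continuous p)
    (hpc : HasCompactSupport p) : ∃ x, x + p x = 0 := by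
  by_contra! hne
  obtain ⟨R, hR, hpR⟩ : ∃ R > 0, ∀ x, R ≤ ‖x‖ → p x = 0 := by
    obtain ⟨R, hR⟩ := hpc.isCompact.isBounded.subset_ball 0
    refine ⟨max R 1, by positivity, fun x hx => image_eq_zero_of_notMem_tsupport fun h => ?_⟩
    have := mem_ball_zero_iff.1 (hR h)
    exact absurd ((le_max_left R 1).trans hx) (not_le.2 this)
  obtain ⟨g, hg, hgp, hgs⟩ := hp.exists_contDiff_approx 1 (ε := fun x => ‖x + p x‖) (by fun_prop)
    fun x => norm_pos_iff.2 (hne x)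
  have hφ : ∀ x, x + g x ≠ 0 := by
    intro x hx
    have h1 := hgp x
    rw [dist_eq_norm, eq_neg_of_add_eq_zero_right hx, ← norm_neg] at h1
    simp [add_comm] at h1
  have hφc : ContDiff ℝ 1 fun x => x + g x := contDiff_id.add (by exact_mod_cast hg)
  refine not_contDiff_retraction (r := fun x => (R / ‖x + g x‖) • (x + g x)) hR ?_ ?_ ?_
  · exact (contDiff_const.div (hφc.norm ℝ hφ) fun x => norm_ne_zero_iff.2 (hφ x)).smul hφc
  · intro x
    rw [norm_smul, norm_div, norm_norm, div_mul_cancel₀ _ (norm_ne_zero_iff.2 (hφ x)),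
      Real.norm_of_nonneg hR.le]
  · intro x hx
    have : g x = 0 := by
      by_contra h
      exact hgs h (hpR x hx.ge)
    simp [this, hx, hR.ne']

open Metric in
/-- A continuous map of a closed ball that is close to the identity has a zero. -/
theorem exists_eq_zero_of_norm_sub_le {V : Type*} [NormedAddCommGroup V]
    [InnerProductSpace ℝ V] [FiniteDimensional ℝ V] (q : C(closedBall (0 : V) 1, V))
    (hq : ∀ b, ‖q b - b‖ ≤ 1 / 4) : ∃ b, q b = 0 := by
  -- extend `q - id` continuously to the whole space, then cut it off between radii `1/2` and `1`
  have : TietzeExtension V := TietzeExtension.of_tvs ℝ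
  obtain ⟨e, he'⟩ := ContinuousMap.exists_restrict_eq (isClosed_closedBall (x := (0 : V)) (ε := 1))
    (q - ⟨Subtype.val, continuous_subtype_val⟩)
  have he : ∀ b : closedBall (0 : V) 1, e b = q b - b := fun b => DFunLike.congr_fun he' b
  let χ : V → ℝ := fun x => max 0 (min 1 (2 - 2 * ‖x‖))
  have hχ : Continuous χ := by fun_prop
  have hχ0 : ∀ x, 1 ≤ ‖x‖ → χ x = 0 := fun x hx =>
    max_eq_left ((min_le_right _ _).trans (by linarith))
  have hχ1 : ∀ x, ‖x‖ ≤ 1 / 2 → χ x = 1 := fun x hx => by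
    simp only [χ]
    rw [min_eq_left (by linarith), max_eq_right zero_le_one]
  have hχI : ∀ x, 0 ≤ χ x ∧ χ x ≤ 1 := fun x =>
    ⟨le_max_left _ _, max_le zero_le_one (min_le_left _ _)⟩
  obtain ⟨x, hx⟩ := exists_add_eq_zero_of_hasCompactSupport (p := fun x => χ x • e x)
    (by fun_prop) (HasCompactSupport.intro (isCompact_closedBall (0 : V) 1) fun x hx => by
      rw [mem_closedBall_zero_iff, not_le] at hx
      rw [hχ0 x hx.le, zero_smul])
  have hx1 : ‖x‖ ≤ 1 := by
    by_contra! h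
    rw [hχ0 x h.le, zero_smul, add_zero] at hx
    simp [hx] at h
    linarith
  have hxm : x ∈ closedBall (0 : V) 1 := by simpa using hx1
  have hex : ‖e x‖ ≤ 1 / 4 := by
    rw [he ⟨x, hxm⟩]
    exact hq _
  have hx2 : ‖x‖ ≤ 1 / 2 := by
    rw [eq_neg_of_add_eq_zero_left hx, norm_neg, norm_smul, Real.norm_of_nonneg (hχI x).1]
    nlinarith [hχI x, norm_nonneg (e x)]
  refine ⟨⟨x, hxm⟩, ?_⟩
  rw [hχ1 x hx2, one_smul, he ⟨x, hxm⟩] at hx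
  simpa using hx

/-! ### Solving linear equations continuously in a compact parameter -/

/-- An almost-solution operator for a linear equation between Banach spaces yields surjectivity. -/
theorem surjective_of_forall_approx {A B : Type*} [NormedAddCommGroup A] [NormedSpace ℝ A]
    [CompleteSpace A] [NormedAddCommGroup B] [NormedSpace ℝ B] (G : A →L[ℝ] B) {M : ℝ}
    (h : ∀ y, ∃ x, ‖x‖ ≤ M * ‖y‖ ∧ ‖G x - y‖ ≤ 1 / 2 * ‖y‖) : Function.Surjective G := by
  choose S hS hS' using h
  intro y
  let e : ℕ → B := fun k => Nat.rec y (fun _ z => z - G (S z)) k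
  have he : ∀ k, ‖e k‖ ≤ (1 / 2) ^ k * ‖y‖ := by
    intro k
    induction k with
    | zero => simp [e]
    | succ k ih =>
      have h1 : e (k + 1) = e k - G (S (e k)) := rfl
      rw [h1, norm_sub_rev]
      refine (hS' _).trans ?_
      rw [pow_succ]
      nlinarith
  have hsum : Summable fun k => S (e k) := by
    have hg : Summable fun k : ℕ => |M| * ((1 / 2 : ℝ) ^ k * ‖y‖) :=
      (summable_geometric_two.mul_right _).mul_left _
    refine Summable.of_norm_bounded hg fun k => (hS _).trans ?_
    exact mul_le_mul (le_abs_self M) (he k) (norm_nonneg _) (abs_nonneg _)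
  refine ⟨∑' k, S (e k), ?_⟩
  have hpart : ∀ N, G (∑ k ∈ Finset.range N, S (e k)) = y - e N := by
    intro N
    induction N with
    | zero => simp [e]
    | succ N ih =>
      have h1 : e (N + 1) = e N - G (S (e N)) := rfl
      rw [Finset.sum_range_succ, map_add, ih, h1]
      abel
  have h0 : Tendsto e atTop (𝓝 0) := by
    refine squeeze_zero_norm he ?_
    simpa using (tendsto_pow_atTop_nhds_zero_of_lt_one (r := (1 / 2 : ℝ)) (by norm_num)
      (by norm_num)).mul_const ‖y‖
  have h1 := (G.continuous.tendsto _).comp hsum.hasSum.tendsto_sum_nat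
  refine tendsto_nhds_unique h1 ?_
  simp only [Function.comp_def, hpart]
  simpa using h0.const_sub y

/-- The operation of composing with a surjective operator between Banach spaces is surjective on
continuous functions on a compact space: linear equations can be solved continuously with respect
to the parameter, although the kernel of the operator need not be complemented. -/
theorem surjective_compLeftContinuous {K Y Z : Type*} [MetricSpace K] [CompactSpace K]
    [NormedAddCommGroup Y] [NormedSpace ℝ Y] [CompleteSpace Y]
    [NormedAddCommGroup Z] [NormedSpace ℝ Z] [CompleteSpace Z] (G : Y →L[ℝ] Z)
    (hG : Function.Surjective G) :
    Function.Surjective (G.compLeftContinuous ℝ K : C(K, Y) →L[ℝ] C(K, Z)) := by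
  obtain ⟨M, hM, hG'⟩ := G.exists_preimage_norm_le hG
  refine surjective_of_forall_approx (M := M) _ fun h => ?_
  rcases eq_or_ne h 0 with rfl | hh
  · exact ⟨0, by simp⟩
  have hpos : 0 < ‖h‖ := norm_pos_iff.2 hh
  obtain ⟨w, hw⟩ := exists_continuous_forall_mem_convex_of_local_const
    (t := fun k : K => {y : Y | ‖y‖ ≤ M * ‖h‖} ∩ {y : Y | ‖G y - h k‖ < 1 / 2 * ‖h‖}) (by
      intro k
      refine Convex.inter ?_ ?_
      · simpa [Metric.closedBall, dist_zero_right] using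
          convex_closedBall (0 : Y) (M * ‖h‖)
      · have := (convex_ball (h k) (1 / 2 * ‖h‖)).is_linear_preimage G.isLinear
        simpa [Metric.ball, dist_eq_norm] using this) (by
      intro k
      obtain ⟨y, hy, hy'⟩ := hG' (h k)
      refine ⟨y, ?_⟩
      have : ∀ᶠ k' in 𝓝 k, ‖h k - h k'‖ < 1 / 2 * ‖h‖ := by
        have hc : ContinuousAt (fun k' => ‖h k - h k'‖) k := by fun_prop
        refine hc.eventually_lt_const ?_
        simpa using hpos
      filter_upwards [this] with k' hk'
      refine ⟨hy'.trans (by gcongr; exact h.norm_coe_le_norm k), ?_⟩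
      simpa [hy] using hk')
  refine ⟨w, (ContinuousMap.norm_le _ (by positivity)).2 fun k => (hw k).1,
    (ContinuousMap.norm_le _ (by positivity)).2 fun k => ?_⟩
  exact le_of_lt (hw k).2

/-! ### Newton iteration and Lyapunov–Schmidt reduction -/

open Metric in
open scoped NNReal in
/-- Nonlinear equations `g k (v k) = 0` that are uniformly close to a surjective linear equation
can be solved continuously in the parameter `k` of a compact space.  This is Newton's method in the
space of continuous functions of `k`. -/
theorem exists_continuousMap_solution {K Y Z : Type*} [MetricSpace K] [CompactSpace K]
    [NormedAddCommGroup Y] [NormedSpace ℝ Y] [CompleteSpace Y]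
    [NormedAddCommGroup Z] [NormedSpace ℝ Z] [CompleteSpace Z] (G : Y →L[ℝ] Z)
    (hG : Function.Surjective G) :
    ∃ c : ℝ, 0 < c ∧ ∀ (g : K → Y → Z) (R : ℝ), 0 ≤ R →
      (∀ v : C(K, Y), (∀ k, ‖v k‖ ≤ R) → Continuous fun k => g k (v k)) →
      (∀ k, ∀ v w : Y, ‖v‖ ≤ R → ‖w‖ ≤ R → ‖g k v - g k w - G (v - w)‖ ≤ c * ‖v - w‖) →
      (∀ k, ‖g k 0‖ ≤ c * R) → ∃ v : C(K, Y), (∀ k, ‖v k‖ ≤ R) ∧ ∀ k, g k (v k) = 0 := by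
  classical
  let Γ : C(K, Y) →L[ℝ] C(K, Z) := G.compLeftContinuous ℝ K
  have hΓ : Γ.range = ⊤ := LinearMap.range_eq_top.2 (surjective_compLeftContinuous G hG)
  let S := Γ.nonlinearRightInverseOfSurjective hΓ
  have hS : 0 < S.nnnorm := Γ.nonlinearRightInverseOfSurjective_nnnorm_pos hΓ
  let c : ℝ≥0 := S.nnnorm⁻¹ / 2
  have hc : 0 < c := by positivity
  refine ⟨c, hc, fun g R hR hcont happ h0 => ?_⟩
  let Θ : C(K, Y) → C(K, Z) := fun v =>
    if h : Continuous fun k => g k (v k) then ⟨_, h⟩ else 0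
  have hball : ∀ v : C(K, Y), v ∈ closedBall 0 R ↔ ∀ k, ‖v k‖ ≤ R := fun v => by
    rw [mem_closedBall_zero_iff, ContinuousMap.norm_le _ hR]
  have hΘ : ∀ v : C(K, Y), v ∈ closedBall 0 R → ∀ k, Θ v k = g k (v k) := fun v hv k => by
    simp only [Θ, dif_pos (hcont v ((hball v).1 hv)), ContinuousMap.coe_mk]
  have hlin : ApproximatesLinearOn Θ Γ (closedBall 0 R) c := by
    intro v hv w hw
    refine (ContinuousMap.norm_le _ (by positivity)).2 fun k => ?_
    have h1 := happ k (v k) (w k) ((hball v).1 hv k) ((hball w).1 hw k)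
    rw [← hΘ v hv, ← hΘ w hw] at h1
    refine h1.trans ?_
    gcongr
    exact (v - w).norm_coe_le_norm k
  have hsurj := hlin.surjOn_closedBall_of_nonlinearRightInverse S hR subset_rfl
  have hcc : ((S.nnnorm : ℝ)⁻¹ - c) = c := by
    simp only [c, NNReal.coe_div, NNReal.coe_inv]
    norm_num
    ring
  obtain ⟨v, hv, hv0⟩ := hsurj (show (0 : C(K, Z)) ∈ _ by
    rw [mem_closedBall, dist_comm, dist_zero_right, hcc,
      ContinuousMap.norm_le _ (by positivity)]
    intro k
    rw [hΘ 0 (by simpa using hR)]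
    exact h0 k)
  refine ⟨v, (hball v).1 hv, fun k => ?_⟩
  rw [← hΘ v hv, hv0]
  rfl

open Metric in
/-- Local surjectivity with finitely many directions `b` that enter only through a curve `x` that
is continuous near `0` and differentiable at `0`, and infinitely many directions `y` in which the
map is strictly differentiable.  A Lyapunov–Schmidt reduction: the equation modulo the finitely
many directions is solved for `y`, continuously in `b`, and the remaining finite-dimensional
equation by Brouwer's theorem.  The map `π` identifies the quotient by the range of
`y ↦ D (0, y)` with the space of the `b`. -/
theorem nhds_zero_le_map_of_hasStrictFDerivAt {X Y V : Type*}
    [NormedAddCommGroup X] [NormedSpace ℝ X] [CompleteSpace X]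
    [NormedAddCommGroup Y] [NormedSpace ℝ Y] [CompleteSpace Y]
    [NormedAddCommGroup V] [InnerProductSpace ℝ V] [FiniteDimensional ℝ V]
    {f : X × Y → X} {D : X × Y →L[ℝ] X} (hf : HasStrictFDerivAt f D 0) (hf0 : f 0 = 0)
    {x : V → X} {Z : V →L[ℝ] X} (hx : HasFDerivAt x Z 0) (hx0 : x 0 = 0)
    (hxc : ∀ᶠ b in 𝓝 0, ContinuousAt x b) (π : X →L[ℝ] V)
    (hker : ∀ z, π z = 0 ↔ ∃ y, D (0, y) = z) (hπ : ∀ b, π (D (Z b, 0)) = b) :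
    𝓝 0 ≤ map (fun p : V × Y => f (x p.1, p.2)) (𝓝 0) := by
  let H : Submodule ℝ X := LinearMap.ker (π : X →ₗ[ℝ] V)
  have hHc : IsClosed (H : Set X) := π.isClosed_ker
  have : CompleteSpace H := hHc.completeSpace_coe
  have hmem : ∀ z, z ∈ H ↔ π z = 0 := fun z => LinearMap.mem_ker
  let G : Y →L[ℝ] H := (D.comp (ContinuousLinearMap.inr ℝ X Y)).codRestrict H fun y =>
    (hmem _).2 ((hker _).2 ⟨y, rfl⟩)
  have hGv : ∀ y, (G y : X) = D (0, y) := fun y => rfl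
  have hG : Function.Surjective G := by
    rintro ⟨z, hz⟩
    obtain ⟨y, hy⟩ := (hker z).1 ((hmem z).1 hz)
    exact ⟨y, Subtype.ext hy⟩
  let P : X →L[ℝ] H := (ContinuousLinearMap.id ℝ X -
    (D.comp (ContinuousLinearMap.inl ℝ X Y)).comp (Z.comp π)).codRestrict H fun z =>
      (hmem _).2 (by simp [hπ])
  have hPv : ∀ z, (P z : X) = z - D (Z (π z), 0) := fun z => rfl
  have hPG : ∀ y, P (D (0, y)) = G y := fun y => by
    ext
    have h0 : D ((0 : X), (0 : Y)) = 0 := map_zero D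
    rw [hPv, (hker _).2 ⟨y, rfl⟩, hGv, map_zero, h0, sub_zero]
  obtain ⟨c, hc, hsol⟩ := exists_continuousMap_solution (K := closedBall (0 : V) 1) G hG
  -- the constants: `c₀` bounds the curve, `c₁` the corrections, `ε` the nonlinear terms
  let a := ‖P‖ + 1
  let p := ‖π‖ + 1
  let d := ‖D‖ + 1
  let c₀ := ‖Z‖ + 1
  let c₁ := a * (d * c₀ + 1) / c
  have ha : 0 < a := by positivity
  have hp : 0 < p := by positivity
  have hd : 0 < d := by positivity
  have hc₀ : 0 < c₀ := by positivity
  have hc₁ : 0 < c₁ := by positivity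
  obtain ⟨ε, hε, hε1, hεa, hεp⟩ : ∃ ε : ℝ, 0 < ε ∧ ε ≤ 1 ∧ a * ε ≤ c ∧
      p * (ε * (c₀ + c₁ + d)) ≤ 1 / 8 := by
    refine ⟨min 1 (min (c / a) (1 / (8 * p * (c₀ + c₁ + d)))), by positivity,
      min_le_left _ _, ?_, ?_⟩
    · rw [mul_comm, ← le_div_iff₀ ha]
      exact (min_le_right _ _).trans (min_le_left _ _)
    · have := (min_le_right 1 _).trans (min_le_right (c / a) (1 / (8 * p * (c₀ + c₁ + d))))
      rw [le_div_iff₀ (by positivity)] at this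
      linarith
  obtain ⟨σ, hσ, hσ1, hσp⟩ : ∃ σ : ℝ, 0 < σ ∧ σ ≤ 1 ∧ p * σ ≤ 1 / 8 := by
    refine ⟨min 1 (1 / (8 * p)), by positivity, min_le_left _ _, ?_⟩
    have := min_le_right 1 (1 / (8 * p))
    rw [le_div_iff₀ (by positivity)] at this
    linarith
  obtain ⟨U, hU, hfU⟩ := hf.approximates_deriv_on_nhds (c := ⟨ε, hε.le⟩) (Or.inr hε)
  obtain ⟨ρ, hρ, hρU⟩ := Metric.mem_nhds_iff.1 hU
  intro W hW
  obtain ⟨η, hη, hηW⟩ := Metric.mem_nhds_iff.1 (mem_map.1 hW)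
  have hxε : ∀ᶠ b in 𝓝 (0 : V), ‖x b - Z b‖ ≤ ε * ‖b‖ := by
    have := hx.isLittleO.def hε
    simpa [hx0] using this
  obtain ⟨r₀, hr₀, hxr⟩ := Metric.eventually_nhds_iff.1 (hxε.and hxc)
  obtain ⟨r, hr, hrr, hrρ, hrη⟩ : ∃ r : ℝ, 0 < r ∧ r < r₀ ∧ (c₀ + c₁) * r < ρ ∧
      (1 + c₁) * r < η := by
    refine ⟨min (r₀ / 2) (min (ρ / (2 * (c₀ + c₁))) (η / (2 * (1 + c₁)))), by positivity,
      (min_le_left _ _).trans_lt (by linarith), ?_, ?_⟩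
    · have := (min_le_right (r₀ / 2) _).trans
        (min_le_left (ρ / (2 * (c₀ + c₁))) (η / (2 * (1 + c₁))))
      rw [le_div_iff₀ (by positivity)] at this
      linarith
    · have := (min_le_right (r₀ / 2) _).trans
        (min_le_right (ρ / (2 * (c₀ + c₁))) (η / (2 * (1 + c₁))))
      rw [le_div_iff₀ (by positivity)] at this
      linarith
  have hkn : ∀ k : closedBall (0 : V) 1, ‖r • (k : V)‖ ≤ r := fun k => by
    rw [norm_smul, Real.norm_of_nonneg hr.le]
    exact mul_le_of_le_one_right hr.le (mem_closedBall_zero_iff.1 k.2)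
  have hxk : ∀ k : closedBall (0 : V) 1, ‖x (r • (k : V)) - Z (r • (k : V))‖ ≤ ε * r ∧
      ContinuousAt x (r • (k : V)) := fun k => by
    have := hxr (y := r • (k : V)) (by simpa using (hkn k).trans_lt hrr)
    exact ⟨this.1.trans (by gcongr; exact hkn k), this.2⟩
  have hxn : ∀ k : closedBall (0 : V) 1, ‖x (r • (k : V))‖ ≤ c₀ * r := fun k => by
    have h1 : ‖Z (r • (k : V))‖ ≤ ‖Z‖ * r := (Z.le_opNorm _).trans (by gcongr; exact hkn k)
    have h2 := norm_le_norm_sub_add (x (r • (k : V))) (Z (r • (k : V)))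
    have h3 := (hxk k).1
    simp only [c₀]
    nlinarith
  have hUm : ∀ k : closedBall (0 : V) 1, ∀ y : Y, ‖y‖ ≤ c₁ * r →
      (x (r • (k : V)), y) ∈ ball 0 ρ := by
    intro k y hy
    rw [mem_ball_zero_iff]
    refine lt_of_le_of_lt ?_ hrρ
    rw [Prod.norm_mk]
    have := hxn k
    exact max_le (by nlinarith) (by nlinarith)
  have hbd : ∀ k : closedBall (0 : V) 1, ∀ y : Y, ‖y‖ ≤ c₁ * r →
      ‖f (x (r • (k : V)), y) - D (x (r • (k : V)), y)‖ ≤ ε * ‖(x (r • (k : V)), y)‖ := by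
    intro k y hy
    have := hfU _ (hρU (hUm k y hy)) _ (hρU (mem_ball_self hρ))
    rwa [hf0, sub_zero, sub_zero] at this
  rw [Metric.mem_nhds_iff]
  refine ⟨σ * r, by positivity, fun z hz => ?_⟩
  have hz' : ‖z‖ ≤ σ * r := by simpa using (mem_ball.1 hz).le
  have hzr : ‖z‖ ≤ r := hz'.trans (mul_le_of_le_one_left hr.le hσ1)
  have hfc : ∀ v : C(closedBall (0 : V) 1, Y), (∀ k, ‖v k‖ ≤ c₁ * r) →
      Continuous fun k : closedBall (0 : V) 1 => f (x (r • (k : V)), v k) := by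
    intro v hv
    rw [continuous_iff_continuousAt]
    intro k
    have h1 : ContinuousAt f (x (r • (k : V)), v k) :=
      hfU.continuousOn.continuousAt (mem_of_superset (isOpen_ball.mem_nhds (hUm k _ (hv k))) hρU)
    have h2 : ContinuousAt (fun k : closedBall (0 : V) 1 => x (r • (k : V))) k :=
      ContinuousAt.comp (f := fun k : closedBall (0 : V) 1 => r • (k : V)) (hxk k).2
        (by fun_prop)
    exact ContinuousAt.comp (f := fun k : closedBall (0 : V) 1 => (x (r • (k : V)), v k)) h1
      (h2.prodMk v.continuous.continuousAt)
  obtain ⟨v, hv, hv0⟩ := hsol (fun k y => P (f (x (r • (k : V)), y) - z)) (c₁ * r) (by positivity)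
    (fun v hv => P.continuous.comp ((hfc v hv).sub continuous_const)) (by
      intro k y w hy hw
      have h1 := hfU _ (hρU (hUm k y hy)) _ (hρU (hUm k w hw))
      have h2 : P (f (x (r • (k : V)), y) - z) - P (f (x (r • (k : V)), w) - z) - G (y - w) =
          P (f (x (r • (k : V)), y) - f (x (r • (k : V)), w) -
            D ((x (r • (k : V)), y) - (x (r • (k : V)), w))) := by
        rw [Prod.mk_sub_mk, sub_self, map_sub P (_ - _) (D _), hPG, ← map_sub,
          sub_sub_sub_cancel_right]
      rw [Prod.mk_sub_mk, sub_self] at h1 h2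
      rw [Prod.norm_mk, norm_zero, max_eq_right (norm_nonneg _)] at h1
      rw [h2]
      calc _ ≤ ‖P‖ * (ε * ‖y - w‖) := (P.le_opNorm _).trans (by gcongr; exact h1)
        _ ≤ (a * ε) * ‖y - w‖ := by
          rw [mul_assoc]
          gcongr
          exact le_add_of_nonneg_right zero_le_one
        _ ≤ c * ‖y - w‖ := by gcongr) (by
      intro k
      have h1 := hbd k 0 (by simpa using (by positivity : 0 ≤ c₁ * r))
      have h2 : ‖(x (r • (k : V)), (0 : Y))‖ ≤ c₀ * r := by simpa using hxn k
      have h3 : ‖D (x (r • (k : V)), 0)‖ ≤ ‖D‖ * (c₀ * r) :=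
        (D.le_opNorm _).trans (by gcongr)
      have h4 : ‖f (x (r • (k : V)), 0)‖ ≤ d * (c₀ * r) := by
        have := norm_le_norm_sub_add (f (x (r • (k : V)), 0)) (D (x (r • (k : V)), 0))
        have h5 : ε * ‖(x (r • (k : V)), (0 : Y))‖ ≤ 1 * (c₀ * r) := by gcongr
        simp only [d]
        linarith
      have h6 := norm_sub_le (f (x (r • (k : V)), 0)) z
      calc _ ≤ ‖P‖ * (d * (c₀ * r) + r) := (P.le_opNorm _).trans (by gcongr; linarith)
        _ ≤ a * (d * (c₀ * r) + r) := by
          gcongr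
          exact le_add_of_nonneg_right zero_le_one
        _ = c * (c₁ * r) := by simp only [c₁]; field_simp)
  let q : C(closedBall (0 : V) 1, V) :=
    ⟨fun k => r⁻¹ • π (f (x (r • (k : V)), v k) - z),
      (π.continuous.comp ((hfc v hv).sub continuous_const)).const_smul r⁻¹⟩
  obtain ⟨k, hk⟩ := exists_eq_zero_of_norm_sub_le q (by
    intro k
    set ξ := x (r • (k : V)) with hξ
    have h1 : q k - k = r⁻¹ • π ((f (ξ, v k) - D (ξ, v k)) +
        D (ξ - Z (r • (k : V)), 0) - z) := by
      have e1 : D (ξ, v k) = D (ξ, 0) + D (0, v k) := by rw [← map_add]; simp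
      have e2 : D (ξ - Z (r • (k : V)), 0) = D (ξ, 0) - D (Z (r • (k : V)), 0) := by
        rw [← map_sub]; simp
      have e3 : π (D (0, v k)) = 0 := (hker _).2 ⟨_, rfl⟩
      have e4 : (k : V) = r⁻¹ • r • (k : V) := (inv_smul_smul₀ hr.ne' _).symm
      change r⁻¹ • π (f (ξ, v k) - z) - k = _
      conv_lhs => rw [e4]
      rw [← smul_sub, e1, e2]
      congr 1
      simp only [map_sub, map_add, e3, hπ]
      abel
    have h2 : ‖f (ξ, v k) - D (ξ, v k)‖ ≤ ε * ((c₀ + c₁) * r) := by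
      refine (hbd k (v k) (hv k)).trans ?_
      gcongr
      rw [Prod.norm_mk]
      exact max_le ((hxn k).trans (by gcongr; linarith)) ((hv k).trans (by gcongr; linarith))
    have h3 : ‖D (ξ - Z (r • (k : V)), 0)‖ ≤ d * (ε * r) := by
      refine (D.le_opNorm _).trans ?_
      have : ‖(ξ - Z (r • (k : V)), (0 : Y))‖ ≤ ε * r := by simpa using (hxk k).1
      gcongr
      exact le_add_of_nonneg_right zero_le_one
    have h4 : ‖(f (ξ, v k) - D (ξ, v k)) + D (ξ - Z (r • (k : V)), 0) - z‖ ≤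
        ε * ((c₀ + c₁) * r) + d * (ε * r) + σ * r :=
      (norm_sub_le _ _).trans (add_le_add ((norm_add_le _ _).trans (add_le_add h2 h3)) hz')
    rw [h1, norm_smul, norm_inv, Real.norm_of_nonneg hr.le]
    calc r⁻¹ * ‖π _‖ ≤ r⁻¹ * (p * (ε * ((c₀ + c₁) * r) + d * (ε * r) + σ * r)) := by
          gcongr
          refine (π.le_opNorm _).trans ?_
          gcongr
          exact le_add_of_nonneg_right zero_le_one
      _ = p * (ε * (c₀ + c₁ + d)) + p * σ := by field_simp
      _ ≤ 1 / 4 := by linarith)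
  have hπ0 : π (f (x (r • (k : V)), v k) - z) = 0 := (smul_eq_zero.1 hk).resolve_left
    (inv_ne_zero hr.ne')
  have hP0 := congrArg (Subtype.val) (hv0 k)
  rw [hPv, hπ0, map_zero] at hP0
  have hfz : f (x (r • (k : V)), v k) = z := by
    have h0 : D ((0 : X), (0 : Y)) = 0 := map_zero D
    rw [h0, sub_zero] at hP0
    exact sub_eq_zero.1 hP0
  rw [← hfz]
  refine hηW (mem_ball_zero_iff.2 ?_ : (r • (k : V), v k) ∈ ball 0 η)
  refine lt_of_le_of_lt ?_ hrη
  rw [Prod.norm_mk]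
  refine max_le ?_ ?_
  · nlinarith [hkn k]
  · nlinarith [hv k]

/-! ### First-order effect of concatenated controls -/

/-- The quantitative bounds enter only through their first-order consequences. -/
theorem IsApproxReachable.exists_control_curve {X : Type*} [NormedAddCommGroup X]
    [NormedSpace ℝ X] {E : ℝ → Type*} [∀ T, NormedAddCommGroup (E T)]
    {F : ∀ T : ℝ, X × E T → X} {ξ : X}
    (hξ : IsApproxReachable F ξ) : ∃ Ξ : ℝ → X, Tendsto Ξ (𝓝[>] 0) (𝓝 ξ) ∧ ∀ T, 0 < T →
      ∃ v : ℝ → E T, Tendsto v (𝓝 0) (𝓝 0) ∧ (∀ᶠ b in 𝓝 0, ContinuousAt v b) ∧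
        HasDerivAt (fun b => F T (0, v b)) (Ξ T) 0 := by
  obtain ⟨Ξ, hΞ, hΞ0, h⟩ := hξ
  refine ⟨Ξ, ?_, fun T hT => ?_⟩
  · rw [← hΞ0]
    exact (hΞ 0 self_mem_Ici).mono_left (nhdsWithin_mono _ Ioi_subset_Ici_self)
  obtain ⟨C, ρ, s, hC, hρ, hs, v, hvc, hv⟩ := h T hT
  have hnhds : Ioo (-ρ) ρ ∈ 𝓝 (0 : ℝ) := Ioo_mem_nhds (neg_lt_zero.2 hρ) hρ
  have hpow : Tendsto (fun b : ℝ => C * |b| ^ s) (𝓝 0) (𝓝 0) := by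
    have h1 : ContinuousAt (fun b : ℝ => C * |b| ^ s) 0 :=
      continuousAt_const.mul (continuous_abs.continuousAt.rpow_const (Or.inr hs.le))
    simpa [ContinuousAt, Real.zero_rpow hs.ne'] using h1
  have h0 : F T (0, v 0) = 0 := by
    have := (hv 0 ⟨neg_lt_zero.2 hρ, hρ⟩).1
    rw [zero_smul, sub_zero, abs_zero, Real.zero_rpow (by positivity), mul_zero] at this
    exact norm_le_zero_iff.1 this
  refine ⟨v, ?_, ?_, ?_⟩
  · refine squeeze_zero_norm' ?_ hpow
    filter_upwards [hnhds] with b hb using (hv b hb).2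
  · filter_upwards [isOpen_Ioo.mem_nhds (show (0 : ℝ) ∈ Ioo (-ρ) ρ from ⟨neg_lt_zero.2 hρ, hρ⟩)]
      with b hb
    exact hvc.continuousAt (isOpen_Ioo.mem_nhds hb)
  · rw [hasDerivAt_iff_isLittleO]
    simp only [h0, sub_zero]
    rw [Asymptotics.isLittleO_iff]
    intro c hc
    filter_upwards [hnhds, hpow.eventually_lt_const hc] with b hb hb'
    refine (hv b hb).1.trans ?_
    rcases eq_or_ne b 0 with rfl | hb0
    · simp [Real.zero_rpow (by positivity : 1 + s ≠ 0)]
    · rw [Real.rpow_add (abs_pos.2 hb0), Real.rpow_one, Real.norm_eq_abs]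
      nlinarith [abs_nonneg b]

theorem ControlFamily.exists_concat_control {X : Type*} {μ : Measure ℝ} [μ.IsAddRightInvariant]
    {U : Type*} [AddCommGroup U] [Module ℝ U] {E : ℝ → Type*} [∀ T, NormedAddCommGroup (E T)]
    [∀ T, NormedSpace ℝ (E T)] {F : ∀ T : ℝ, X × E T → X} (𝓔 : ControlFamily μ U E)
    (hA₃ : SemigroupProperty 𝓔 F)
    {T₁ T₂ : ℝ} (h₁ : 0 < T₁) (h₂ : 0 < T₂) :
    ∃ cat : E T₁ → E T₂ → E (T₁ + T₂), (∀ u v, ‖cat u v‖ ≤ ‖u‖ + ‖v‖) ∧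
      ∀ x u v, F (T₁ + T₂) (x, cat u v) = F T₂ (F T₁ (x, u), v) := by
  choose cat hcat using 𝓔.exists_concat T₁ T₂ h₁ h₂
  exact ⟨cat, fun u v => 𝓔.norm_concat_le T₁ T₂ h₁ h₂ u v _ (hcat u v),
    fun x u v => hA₃ T₁ T₂ h₁ h₂ x u v _ (hcat u v)⟩

theorem tendsto_concat_control {A E₁ E₂ E₃ : Type*} [SeminormedAddCommGroup E₁]
    [SeminormedAddCommGroup E₂] [SeminormedAddCommGroup E₃] {l : Filter A} {cat : E₁ → E₂ → E₃}
    (hcat : ∀ u v, ‖cat u v‖ ≤ ‖u‖ + ‖v‖) {u : A → E₁} {v : A → E₂} (hu : Tendsto u l (𝓝 0))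
    (hv : Tendsto v l (𝓝 0)) : Tendsto (fun a => cat (u a) (v a)) l (𝓝 0) := by
  refine squeeze_zero_norm (fun a => hcat _ _) ?_
  simpa using hu.norm.add hv.norm

section Curves

variable {X : Type*} [NormedAddCommGroup X] [NormedSpace ℝ X]
  {E : ℝ → Type*} [∀ T, NormedAddCommGroup (E T)] [∀ T, NormedSpace ℝ (E T)]

/-- `F T` is locally onto from zero: small targets are reached from `0` by small controls. -/
def IsLocallyOnto (F : ∀ T : ℝ, X × E T → X) (T : ℝ) : Prop :=
  𝓝 (0 : X) ≤ map (fun u : E T => F T (0, u)) (𝓝 0)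

/-- The linear map `Z` is realized in time `T`: a family of controls indexed by `b`, tending to `0`
with `b`, reaches `Z b` up to `o(b)`, and its end-points depend continuously on `b` near `0`. No
continuity of the controls themselves is required, since only the end-points matter. -/
def IsRealized (F : ∀ T : ℝ, X × E T → X) {V : Type*} [NormedAddCommGroup V] [NormedSpace ℝ V]
    (T : ℝ) (Z : V →L[ℝ] X) : Prop :=
  ∃ u : V → E T, Tendsto u (𝓝 0) (𝓝 0) ∧ HasFDerivAt (fun b => F T (0, u b)) Z 0 ∧
    ∀ᶠ b in 𝓝 0, ContinuousAt (fun b => F T (0, u b)) b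

theorem IsC2NearZero.hasStrictFDerivAt {F : ∀ T : ℝ, X × E T → X} (hF : IsC2NearZero F) {T : ℝ}
    (hT : 0 < T) : HasStrictFDerivAt (F T) (fderiv ℝ (F T) (0, 0)) (0, 0) := by
  obtain ⟨-, W, hW, h0, hc⟩ := hF T hT
  exact (hc.contDiffAt (hW.mem_nhds h0)).hasStrictFDerivAt two_ne_zero

theorem IsC2NearZero.eventually_continuousAt {F : ∀ T : ℝ, X × E T → X} (hF : IsC2NearZero F)
    {T : ℝ} (hT : 0 < T) : ∀ᶠ p in 𝓝 ((0 : X), (0 : E T)), ContinuousAt (F T) p := by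
  obtain ⟨-, W, hW, h0, hc⟩ := hF T hT
  filter_upwards [hW.mem_nhds h0] with p hp
  exact hc.continuousOn.continuousAt (hW.mem_nhds hp)

/-- Following a curve of end-points by a curve of controls: the first-order terms add up, after
transport of the first one by the linearized flow.  The controls being small but possibly much
larger than their first-order effect, this rests on strict differentiability, applied to the pairs
`(x b, v b)` and `(0, v b)`. -/
theorem hasFDerivAt_comp_control {V Y : Type*} [NormedAddCommGroup V] [NormedSpace ℝ V]
    [NormedAddCommGroup Y] [NormedSpace ℝ Y] {f : X × Y → X} {D : X × Y →L[ℝ] X}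
    (hf : HasStrictFDerivAt f D (0, 0)) {x : V → X} {Z Z' : V →L[ℝ] X} (hx : HasFDerivAt x Z 0)
    (hx0 : x 0 = 0) {v : V → Y} (hv : Tendsto v (𝓝 0) (𝓝 0))
    (hv' : HasFDerivAt (fun b => f (0, v b)) Z' 0) :
    HasFDerivAt (fun b => f (x b, v b)) ((D.comp (ContinuousLinearMap.inl ℝ X Y)).comp Z + Z')
      0 := by
  have hxt : Tendsto x (𝓝 0) (𝓝 0) := by simpa [ContinuousAt, hx0] using hx.continuousAt
  have h1 : HasFDerivAt (fun b => D (x b, 0))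
      ((D.comp (ContinuousLinearMap.inl ℝ X Y)).comp Z) 0 :=
    (D.comp (ContinuousLinearMap.inl ℝ X Y)).hasFDerivAt.comp 0 hx
  have h2 : HasFDerivAt (fun b => f (x b, v b) - f (0, v b) - D (x b, 0)) (0 : V →L[ℝ] X) 0 := by
    rw [hasFDerivAt_iff_isLittleO]
    have h3 : Tendsto (fun b => ((x b, v b), ((0 : X), v b))) (𝓝 0) (𝓝 ((0, 0), (0, 0))) :=
      (hxt.prodMk_nhds hv).prodMk_nhds (tendsto_const_nhds.prodMk_nhds hv)
    have h4 := (hasStrictFDerivAt_iff_isLittleO.1 hf).comp_tendsto h3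
    have h5 : (fun b : V => x b) =O[𝓝 0] fun b => b := by
      simpa [hx0] using hx.isBigO_sub
    have h6 : (fun b => f (x b, v b) - f (0, v b) - D (x b, 0)) =o[𝓝 0] fun b => x b := by
      refine (h4.congr_left fun b => ?_).trans_isBigO
        (Asymptotics.isBigO_of_le _ fun b => ?_)
      · simp [-map_sub]
      · simp
    have h7 : D ((0 : X), (0 : Y)) = 0 := map_zero D
    simpa [hx0, h7] using h6.trans_isBigO h5
  have h8 := (h2.add h1).add hv'
  rw [zero_add] at h8
  exact h8.congr_of_eventuallyEq (Eventually.of_forall fun b => by simp)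

variable {μ : Measure ℝ} [μ.IsAddRightInvariant] {U : Type*} [AddCommGroup U] [Module ℝ U]
  {F : ∀ T : ℝ, X × E T → X}

/-- Concatenation adds one direction to those that are realized, and transports the latter by the
linearized flow. -/
theorem IsRealized.concat (𝓔 : ControlFamily μ U E) (hA₁ : IsC2NearZero F)
    (hA₃ : SemigroupProperty 𝓔 F) {V : Type*} [NormedAddCommGroup V] [NormedSpace ℝ V]
    {T₁ T₂ : ℝ} (h₁ : 0 < T₁) (h₂ : 0 < T₂) {Z : V →L[ℝ] X} (hZ : IsRealized F T₁ Z)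
    {v : ℝ → E T₂} {ζ : X} (hv : Tendsto v (𝓝 0) (𝓝 0)) (hvc : ∀ᶠ b in 𝓝 0, ContinuousAt v b)
    (hvd : HasDerivAt (fun b => F T₂ (0, v b)) ζ 0) (ℓ : V →L[ℝ] ℝ) :
    IsRealized F (T₁ + T₂) (((fderiv ℝ (F T₂) (0, 0)).comp
      (ContinuousLinearMap.inl ℝ X (E T₂))).comp Z + ℓ.smulRight ζ) := by
  obtain ⟨u, hu, hud, huc⟩ := hZ
  obtain ⟨cat, hcat, hcatF⟩ := 𝓔.exists_concat_control hA₃ h₁ h₂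
  have hℓ : Tendsto ℓ (𝓝 0) (𝓝 0) := by simpa using ℓ.continuous.tendsto 0
  have hu0 : u 0 = 0 := eq_of_tendsto_nhds hu
  have hx0 : F T₁ (0, u 0) = 0 := by rw [hu0]; exact (hA₁ T₁ h₁).1
  have hvℓ : HasFDerivAt (fun b => F T₂ (0, v (ℓ b))) (ℓ.smulRight ζ) 0 := by
    have h3 : HasFDerivAt (fun b => F T₂ (0, v b))
        (ContinuousLinearMap.toSpanSingleton ℝ ζ) (ℓ 0) := by
      rw [map_zero]; exact hvd.hasFDerivAt
    have h4 : ℓ.smulRight ζ = (ContinuousLinearMap.toSpanSingleton ℝ ζ).comp ℓ := by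
      ext b; simp
    rw [h4]
    exact h3.comp 0 ℓ.hasFDerivAt
  refine ⟨fun b => cat (u b) (v (ℓ b)), tendsto_concat_control hcat hu (hv.comp hℓ), ?_, ?_⟩
  · simp only [hcatF]
    exact hasFDerivAt_comp_control (hA₁.hasStrictFDerivAt h₂) hud hx0 (hv.comp hℓ) hvℓ
  · simp only [hcatF]
    have hxt : Tendsto (fun b => F T₁ (0, u b)) (𝓝 0) (𝓝 0) := by
      have := hud.continuousAt.tendsto
      rwa [hx0] at this
    filter_upwards [huc, hℓ.eventually hvc,
      (hxt.prodMk_nhds (hv.comp hℓ)).eventually (hA₁.eventually_continuousAt h₂)] with b h3 h4 h5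
    exact ContinuousAt.comp (f := fun b => (F T₁ (0, u b), v (ℓ b))) h5
      (h3.prodMk (ContinuousAt.comp (f := ℓ) h4 ℓ.continuous.continuousAt))

theorem LinearizationTimeContinuous.eventually_norm_sub_lt (hA₂ : LinearizationTimeContinuous F)
    {ι : Type*} [Finite ι] (w : ι → X) {ε : ℝ} (hε : 0 < ε) :
    ∀ᶠ T in 𝓝[>] (0 : ℝ), ∀ i, ‖fderiv ℝ (F T) (0, 0) (w i, 0) - w i‖ < ε := by
  refine eventually_all.2 fun i => ?_
  have := ((hA₂ (w i)).2.sub_const (w i)).norm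
  rw [sub_self, norm_zero] at this
  exact this.eventually_lt_const hε

/-- In arbitrarily small time, one realizes a linear map whose values on the canonical basis are as
close as desired to the approximately reachable vectors `ξ i`: the corresponding controls are used
one after the other, during times so short that the linearized flow hardly moves the vectors
obtained before. -/
theorem exists_isRealized_near (𝓔 : ControlFamily μ U E) (hA₁ : IsC2NearZero F)
    (hA₂ : LinearizationTimeContinuous F) (hA₃ : SemigroupProperty 𝓔 F) {n : ℕ} {ξ : Fin n → X}
    (hξ : ∀ i, IsApproxReachable F (ξ i)) (s : Finset (Fin n)) {ε τ : ℝ} (hε : 0 < ε)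
    (hτ : 0 < τ) : ∃ (T : ℝ) (Z : EuclideanSpace ℝ (Fin n) →L[ℝ] X), 0 < T ∧ T < τ ∧
      IsRealized F T Z ∧ (∀ i ∈ s, ‖Z (EuclideanSpace.single i 1) - ξ i‖ < ε) ∧
      ∀ i ∉ s, Z (EuclideanSpace.single i 1) = 0 := by
  classical
  induction s using Finset.induction_on generalizing ε τ with
  | empty =>
    have h0 := (hA₁ (τ / 2) (half_pos hτ)).1
    refine ⟨τ / 2, 0, half_pos hτ, half_lt_self hτ, ⟨0, tendsto_const_nhds, ?_, ?_⟩, by simp,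
      by simp⟩
    · simpa using hasFDerivAt_const _ _
    · exact Eventually.of_forall fun b => continuousAt_const
  | insert j s hj ih =>
    obtain ⟨T₁, Z, hT₁, hT₁τ, hZ, hZs, hZn⟩ := ih (half_pos hε) (half_pos hτ)
    obtain ⟨Ξ, hΞ, hv⟩ := (hξ j).exists_control_curve
    have hΞε : ∀ᶠ T in 𝓝[>] (0 : ℝ), ‖Ξ T - ξ j‖ < ε := by
      have := (hΞ.sub_const (ξ j)).norm
      rw [sub_self, norm_zero] at this
      exact this.eventually_lt_const hε
    obtain ⟨T₂, h3, h4, hT₂, hT₂τ⟩ := ((hA₂.eventually_norm_sub_lt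
      (fun i => Z (EuclideanSpace.single i 1)) (half_pos hε)).and (hΞε.and
        (Ioo_mem_nhdsGT (half_pos hτ)))).exists
    obtain ⟨v, hv1, hv2, hv3⟩ := hv T₂ hT₂
    have hD0 : fderiv ℝ (F T₂) (0, 0) ((0 : X), (0 : E T₂)) = 0 := map_zero _
    refine ⟨T₁ + T₂, _, by positivity, by linarith,
      hZ.concat 𝓔 hA₁ hA₃ hT₁ hT₂ hv1 hv2 hv3 (EuclideanSpace.proj j), ?_, ?_⟩
    · intro i hi
      rcases eq_or_ne i j with rfl | hij
      · simpa [hZn i hj, hD0] using h4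
      · have h5 := hZs i (Finset.mem_of_mem_insert_of_ne hi hij)
        have h6 := h3 i
        have h7 := norm_sub_le_norm_sub_add_norm_sub
          (fderiv ℝ (F T₂) (0, 0) (Z (EuclideanSpace.single i 1), 0))
          (Z (EuclideanSpace.single i 1)) (ξ i)
        have h8 : (((fderiv ℝ (F T₂) (0, 0)).comp (ContinuousLinearMap.inl ℝ X (E T₂))).comp Z +
            (EuclideanSpace.proj j : EuclideanSpace ℝ (Fin n) →L[ℝ] ℝ).smulRight (Ξ T₂))
            (EuclideanSpace.single i 1) =
            fderiv ℝ (F T₂) (0, 0) (Z (EuclideanSpace.single i 1), 0) := by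
          simp [hij.symm]
        rw [h8]
        linarith
    · intro i hi
      rw [Finset.mem_insert, not_or] at hi
      simp [hZn i hi.2, Ne.symm hi.1, hD0]

/-! ### Directions transverse to the linearized range -/

/-- The projection along `H` onto a complement, in the coordinates of a basis of the latter. -/
theorem exists_coordinate_map {H M : Submodule ℝ X} (hH : IsClosed (H : Set X))
    [FiniteDimensional ℝ (X ⧸ H)] (hHM : IsCompl H M) {n : ℕ} (ξ : Module.Basis (Fin n) ℝ M) :
    ∃ π : X →L[ℝ] EuclideanSpace ℝ (Fin n), (∀ z, π z = 0 ↔ z ∈ H) ∧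
      ∀ i, π (ξ i) = EuclideanSpace.single i 1 := by
  let e : (X ⧸ H) ≃ₗ[ℝ] EuclideanSpace ℝ (Fin n) := (H.quotientEquivOfIsCompl M hHM).trans
    (ξ.equiv (EuclideanSpace.basisFun (Fin n) ℝ).toBasis (Equiv.refl _))
  let φ : (X ⧸ H) →L[ℝ] EuclideanSpace ℝ (Fin n) := e.toLinearMap.toContinuousLinearMap
  have hφ : ∀ z : X, (φ.comp H.mkQL) z = e (H.mkQ z) := fun z => rfl
  refine ⟨φ.comp H.mkQL, fun z => ?_, fun i => ?_⟩
  · rw [hφ, e.map_eq_zero_iff, Submodule.mkQ_apply, Submodule.Quotient.mk_eq_zero]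
  · rw [hφ]
    simp [e]

/-- A linear map sending the canonical basis close to vectors with coordinates `single i 1` is
invertible modulo the kernel of the coordinate map. -/
theorem exists_forall_isUnit_comp {n : ℕ} (π : X →L[ℝ] EuclideanSpace ℝ (Fin n)) (ξ : Fin n → X)
    (hπ : ∀ i, π (ξ i) = EuclideanSpace.single i 1) :
    ∃ ε > 0, ∀ B : EuclideanSpace ℝ (Fin n) →L[ℝ] X,
      (∀ i, ‖B (EuclideanSpace.single i 1) - ξ i‖ < ε) → IsUnit (π.comp B) := by
  let Φ : (Fin n → X) → (EuclideanSpace ℝ (Fin n) →L[ℝ] EuclideanSpace ℝ (Fin n)) := fun w =>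
    ∑ i, (EuclideanSpace.proj i : EuclideanSpace ℝ (Fin n) →L[ℝ] ℝ).smulRight (π (w i))
  have hΦc : Continuous Φ := by
    refine continuous_finsetSum _ fun i _ => ?_
    exact ((ContinuousLinearMap.smulRightL ℝ (EuclideanSpace ℝ (Fin n))
      (EuclideanSpace ℝ (Fin n))) (EuclideanSpace.proj i)).continuous.comp (by fun_prop)
  have hext : ∀ A : EuclideanSpace ℝ (Fin n) →L[ℝ] EuclideanSpace ℝ (Fin n), ∀ w : Fin n → X,
      (∀ i, A (EuclideanSpace.single i 1) = π (w i)) → A = Φ w := by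
    intro A w h
    apply ContinuousLinearMap.coe_injective
    refine (EuclideanSpace.basisFun (Fin n) ℝ).toBasis.ext fun i => ?_
    simp [Φ, h]
  have h1 : Φ ξ = 1 := (hext 1 ξ fun i => (hπ i).symm).symm
  have hU : ∀ᶠ w in 𝓝 ξ, IsUnit (Φ w) := by
    refine hΦc.continuousAt.eventually ?_
    rw [h1]
    exact Units.isOpen.mem_nhds isUnit_one
  obtain ⟨ε, hε, hεU⟩ := Metric.eventually_nhds_iff.1 hU
  refine ⟨ε, hε, fun B hB => ?_⟩
  rw [hext (π.comp B) (fun i => B (EuclideanSpace.single i 1)) fun i => rfl]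
  refine hεU ((dist_pi_lt_iff hε).2 fun i => ?_)
  rw [dist_eq_norm]
  exact hB i

/-! ### Local surjectivity -/

/-- Local surjectivity passes to longer times, by waiting at the equilibrium `0` first. -/
theorem isLocallyOnto_add (𝓔 : ControlFamily μ U E) (hA₁ : IsC2NearZero F)
    (hA₃ : SemigroupProperty 𝓔 F) {T₁ T₂ : ℝ} (h₁ : 0 < T₁) (h₂ : 0 < T₂)
    (h : IsLocallyOnto F T₂) : IsLocallyOnto F (T₁ + T₂) := by
  obtain ⟨cat, hcat, hcatF⟩ := 𝓔.exists_concat_control hA₃ h₁ h₂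
  refine h.trans ?_
  have h3 : (fun u : E T₂ => F T₂ (0, u)) =
      (fun w : E (T₁ + T₂) => F (T₁ + T₂) (0, w)) ∘ fun u => cat 0 u := by
    ext u
    rw [Function.comp_apply, hcatF, (hA₁ T₁ h₁).1]
  rw [h3, ← map_map]
  exact map_mono (tendsto_concat_control hcat tendsto_const_nhds tendsto_id)

/-- Realizing directions that are transverse to `H`, then using controls in a complete space whose
linearized effect is `H`, gives local surjectivity. -/
theorem isLocallyOnto_of_isRealized [CompleteSpace X] (𝓔 : ControlFamily μ U E)
    (hA₁ : IsC2NearZero F) (hA₃ : SemigroupProperty 𝓔 F) {H : Submodule ℝ X} {n : ℕ}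
    (π : X →L[ℝ] EuclideanSpace ℝ (Fin n)) (hπ : ∀ z, π z = 0 ↔ z ∈ H) {T₁ T₂ : ℝ}
    (h₁ : 0 < T₁) (h₂ : 0 < T₂) {Z : EuclideanSpace ℝ (Fin n) →L[ℝ] X} (hZ : IsRealized F T₁ Z)
    (hunit : IsUnit (π.comp (((fderiv ℝ (F T₂) (0, 0)).comp
      (ContinuousLinearMap.inl ℝ X (E T₂))).comp Z)))
    {Y : Type*} [NormedAddCommGroup Y] [NormedSpace ℝ Y] [CompleteSpace Y] (j : Y →L[ℝ] E T₂)
    (hj : ∀ z, z ∈ H ↔ ∃ y, fderiv ℝ (F T₂) (0, 0) (0, j y) = z) :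
    IsLocallyOnto F (T₁ + T₂) := by
  obtain ⟨cat, hcat, hcatF⟩ := 𝓔.exists_concat_control hA₃ h₁ h₂
  obtain ⟨u, hu, hud, huc⟩ := hZ
  obtain ⟨A, hA⟩ := hunit
  set D := fderiv ℝ (F T₂) (0, 0) with hD
  have hu0 : u 0 = 0 := eq_of_tendsto_nhds hu
  let B : EuclideanSpace ℝ (Fin n) →L[ℝ] EuclideanSpace ℝ (Fin n) := ↑A⁻¹
  have hBA : ∀ b, B (π (D (Z b, 0))) = b := fun b => by
    have h3 : B * (π.comp ((D.comp (ContinuousLinearMap.inl ℝ X (E T₂))).comp Z)) = 1 := by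
      rw [← hA]
      exact A.inv_mul
    exact DFunLike.congr_fun h3 b
  have hB : Function.Injective B := by
    refine Function.LeftInverse.injective (g := (A : _ →L[ℝ] EuclideanSpace ℝ (Fin n))) fun b => ?_
    exact DFunLike.congr_fun A.mul_inv b
  have hBπ : ∀ z, B.comp π z = 0 ↔ π z = 0 := fun z => map_eq_zero_iff B hB
  let J : X × Y →L[ℝ] X × E T₂ := (ContinuousLinearMap.id ℝ X).prodMap j
  have hf : HasStrictFDerivAt (fun p : X × Y => F T₂ (J p)) (D.comp J) 0 := by
    refine HasStrictFDerivAt.comp 0 ?_ J.hasStrictFDerivAt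
    have : J 0 = (0, 0) := map_zero J
    rw [this]
    exact hA₁.hasStrictFDerivAt h₂
  have hmain := nhds_zero_le_map_of_hasStrictFDerivAt hf
    (by rw [map_zero]; exact (hA₁ T₂ h₂).1) hud (by rw [hu0]; exact (hA₁ T₁ h₁).1) huc
    (B.comp π) (fun z => by rw [hBπ, hπ, hj]; rfl) (fun b => by
      have h4 : D.comp J (Z b, 0) = D (Z b, 0) := by simp [J]
      rw [h4]
      exact hBA b)
  refine hmain.trans ?_
  have h3 : (fun p : EuclideanSpace ℝ (Fin n) × Y => F T₂ (J (F T₁ (0, u p.1), p.2))) =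
      (fun w : E (T₁ + T₂) => F (T₁ + T₂) (0, w)) ∘ fun p => cat (u p.1) (j p.2) := by
    ext p
    rw [Function.comp_apply, hcatF]
    rfl
  rw [h3, ← map_map]
  refine map_mono (tendsto_concat_control hcat (hu.comp ?_) ?_)
  · exact (continuous_fst.tendsto' _ _ rfl)
  · exact ((j.continuous.comp continuous_snd).tendsto' _ _ (by simp))

end Curves

end ControlVariations

open ControlVariations in
theorem theorem2p1
    {X : Type*} [NormedAddCommGroup X] [NormedSpace ℝ X] [CompleteSpace X]
    (μ : Measure ℝ) [μ.IsAddRightInvariant]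
    {U : Type*} [AddCommGroup U] [Module ℝ U]
    {E : ℝ → Type*} [∀ T, NormedAddCommGroup (E T)] [∀ T, NormedSpace ℝ (E T)]
    (𝓔 : ControlVariations.ControlFamily μ U E)
    (hE : FiniteDimensional ℝ X ∨ ∀ T, 0 < T → CompleteSpace (E T))
    (F : ∀ T : ℝ, X × E T → X) (H : Submodule ℝ X) (n : ℕ)
    (hA₁ : ControlVariations.IsC2NearZero F)
    (hA₂ : ControlVariations.LinearizationTimeContinuous F)
    (hA₃ : ControlVariations.SemigroupProperty 𝓔 F)
    (hA₄ : ControlVariations.HasLinearizedRange F H n)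
    (hA₅ : ControlVariations.HasReachableComplement F H n) :
    ∀ T : ℝ, 0 < T → ∀ η : ℝ, 0 < η → ∃ δ : ℝ, 0 < δ ∧
      ∀ x_f : X, ‖x_f‖ < δ → ∃ u : E T, ‖u‖ < η ∧ F T (0, u) = x_f := by
  obtain ⟨hrange, hHc, hfin, -⟩ := hA₄
  obtain ⟨M, hHM, ξ, hξ⟩ := hA₅
  intro T hT
  obtain ⟨π, hπ, hπξ⟩ := exists_coordinate_map hHc hHM ξ
  obtain ⟨ε, hε, hunit⟩ := exists_forall_isUnit_comp π (fun i => (ξ i : X)) hπξ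
  obtain ⟨T₁, Z, hT₁, hT₁T, hZ, hZξ, -⟩ := exists_isRealized_near 𝓔 hA₁ hA₂ hA₃ hξ Finset.univ
    (half_pos hε) (half_pos hT)
  obtain ⟨T₂, h3, hT₂, hT₂T⟩ := ((hA₂.eventually_norm_sub_lt
    (fun i => Z (EuclideanSpace.single i 1)) (half_pos hε)).and
      (Ioo_mem_nhdsGT (half_pos hT))).exists
  have hrange' : ∀ z, z ∈ H ↔ ∃ y, fderiv ℝ (F T₂) (0, 0) (0, y) = z := fun z => by
    rw [← SetLike.mem_coe, ← hrange T₂ hT₂]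
    rfl
  have hunit' := hunit (((fderiv ℝ (F T₂) (0, 0)).comp
      (ContinuousLinearMap.inl ℝ X (E T₂))).comp Z) fun i => by
    have h4 := norm_sub_le_norm_sub_add_norm_sub
      (fderiv ℝ (F T₂) (0, 0) (Z (EuclideanSpace.single i 1), 0))
      (Z (EuclideanSpace.single i 1)) (ξ i)
    have h5 := hZξ i (Finset.mem_univ i)
    have h6 := h3 i
    simp only [ContinuousLinearMap.comp_apply, ContinuousLinearMap.inl_apply]
    linarith
  have honto : IsLocallyOnto F (T₁ + T₂) := by
    rcases hE with hX | hE
    · -- without completeness of the controls, use a right inverse of the linearized control map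
      let G : E T₂ →ₗ[ℝ] H := LinearMap.codRestrict H
        ((fderiv ℝ (F T₂) (0, 0)).comp (ContinuousLinearMap.inr ℝ X (E T₂)) : E T₂ →ₗ[ℝ] X)
        fun y => (hrange' _).2 ⟨y, rfl⟩
      obtain ⟨S, hS⟩ := G.exists_rightInverse_of_surjective (LinearMap.range_eq_top.2 fun z => by
        obtain ⟨y, hy⟩ := (hrange' z).1 z.2
        exact ⟨y, Subtype.ext hy⟩)
      have hS' : ∀ z : H, fderiv ℝ (F T₂) (0, 0) (0, S z) = z := fun z =>
        congrArg Subtype.val (LinearMap.congr_fun hS z)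
      have : CompleteSpace H := FiniteDimensional.complete ℝ H
      exact isLocallyOnto_of_isRealized 𝓔 hA₁ hA₃ π hπ hT₁ hT₂ hZ hunit'
        (LinearMap.toContinuousLinearMap S) fun z =>
          ⟨fun hz => ⟨⟨z, hz⟩, hS' ⟨z, hz⟩⟩, fun ⟨y, hy⟩ => (hrange' z).2 ⟨_, hy⟩⟩
    · have := hE T₂ hT₂
      exact isLocallyOnto_of_isRealized 𝓔 hA₁ hA₃ π hπ hT₁ hT₂ hZ hunit'
        (ContinuousLinearMap.id ℝ (E T₂)) hrange'
  obtain ⟨T₀, hT₀, rfl⟩ : ∃ T₀, 0 < T₀ ∧ T₀ + (T₁ + T₂) = T :=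
    ⟨T - (T₁ + T₂), by linarith, by ring⟩
  have h := isLocallyOnto_add 𝓔 hA₁ hA₃ hT₀ (add_pos hT₁ hT₂) honto
  intro η hη
  obtain ⟨δ, hδ, hδ'⟩ := Metric.mem_nhds_iff.1 (h (image_mem_map (Metric.ball_mem_nhds 0 hη)))
  refine ⟨δ, hδ, fun x_f hx => ?_⟩
  obtain ⟨u, hu, rfl⟩ := hδ' (mem_ball_zero_iff.2 hx)
  exact ⟨u, mem_ball_zero_iff.1 hu, rfl⟩
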